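/- Let $K$ be a field, $R=K[x_1,\dots,x_n]$, and $\mathfrak m=(x_1,\dots,x_n)$. For an ideal $I\subseteq R$ let $\mathrm{ass}(I)$ be the set of associated prime ideals of the $R$-module $R/I$; $I$ is called unmixed if $\dim R/I=\dim R/\mathfrak p$ for all $\mathfrak p\in\mathrm{ass}(I)$. The class of ass-decomposable monomial ideals is defined recursively: a monomial ideal $I$ is ass-decomposable if either $I$ is a primary ideal, or there exist a variable $x_i\notin\sqrt I$ and an integer $k\ge 1$ such that (i) $\mathrm{ass}((I,x_i^k))=\{\mathfrak p\in\mathrm{ass}(I): x_i\in\mathfrak p\}$, and (ii) both $(I,x_i^k)$ and $I:x_i^k$ are ass-decomposable. For a finitely generated $R$-module $M$, let $\mathrm{depth}(M)$ denote the supremum of the lengths of the $M$-regular sequences contained in $\mathfrak m$. For a monomial ideal $I$, a Stanley decomposition of $R/I$ is a finite decomposition $R/I=\bigoplus_{j=1}^{r}u_jK[Z_j]$ as a $K$-vector space, where $u_j\in R/I$ is homogeneous with respect to the $\mathbb Z^n$-grading, $Z_j\subseteq\{x_1,\dots,x_n\}$, and $u_jK[Z_j]$ is a free $K[Z_j]$-module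 with basis $u_j$; $\mathrm{sdepth}(R/I)$ is the maximum, over all Stanley decompositions of $R/I$, of $\min_j|Z_j|$. Then every unmixed ass-decomposable monomial ideal $I\subseteq R$ satisfies Stanley's inequality $$\mathrm{sdepth}(R/I)\ \ge\ \mathrm{depth}(R/I).$$ -/

import Mathlib

namespace StanleyIneq

open MvPolynomial

variable {K : Type*} [Field K] {n : ℕ}

/-- A monomial ideal of `K[x₁, …, xₙ]`: an ideal generated by a set of monomials. -/
def IsMonomialIdeal (I : Ideal (MvPolynomial (Fin n) K)) : Prop :=
  ∃ S : Set (Fin n →₀ ℕ), I = Ideal.span ((fun a => monomial a (1 : K)) '' S)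

/-- `ass(I)`, the set of associated prime ideals of the module `R / I`. -/
def ass (I : Ideal (MvPolynomial (Fin n) K)) : Set (Ideal (MvPolynomial (Fin n) K)) :=
  associatedPrimes (MvPolynomial (Fin n) K) (MvPolynomial (Fin n) K ⧸ I)

/-- `I` is unmixed: `dim R / p = dim R / I` for all `p ∈ ass(I)`. -/
def IsUnmixed (I : Ideal (MvPolynomial (Fin n) K)) : Prop :=
  ∀ p ∈ ass I, ringKrullDim (MvPolynomial (Fin n) K ⧸ I) =
    ringKrullDim (MvPolynomial (Fin n) K ⧸ p)

/-- Ass-decomposable monomial ideals: a monomial ideal `I` is ass-decomposable if it is primary, or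
if there are a variable `xᵢ ∉ √I` and `k ≥ 1` with `ass(I, xᵢᵏ) = {p ∈ ass(I) | xᵢ ∈ p}` such that
`(I, xᵢᵏ)` and `I : xᵢᵏ` are ass-decomposable. -/
inductive IsAssDecomposable : Ideal (MvPolynomial (Fin n) K) → Prop
  | primary (I : Ideal (MvPolynomial (Fin n) K)) (hI : IsMonomialIdeal I) (hp : I.IsPrimary) :
      IsAssDecomposable I
  | step (I : Ideal (MvPolynomial (Fin n) K)) (hI : IsMonomialIdeal I) (i : Fin n) (k : ℕ)
      (hi : (X i : MvPolynomial (Fin n) K) ∉ I.radical) (hk : 0 < k)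
      (hass : ass (I ⊔ Ideal.span {(X i : MvPolynomial (Fin n) K) ^ k}) =
        {p ∈ ass I | (X i : MvPolynomial (Fin n) K) ∈ p})
      (hadd : IsAssDecomposable (I ⊔ Ideal.span {(X i : MvPolynomial (Fin n) K) ^ k}))
      (hcolon : IsAssDecomposable (Submodule.colon I {(X i : MvPolynomial (Fin n) K) ^ k})) :
      IsAssDecomposable I

/-- The depth of an `R`-module `M` (with respect to the irrelevant maximal ideal
`𝔪 = (x₁, …, xₙ)`): the supremum of the lengths of `M`-regular sequences contained in `𝔪`. -/
noncomputable def depth (M : Type*) [AddCommGroup M] [Module (MvPolynomial (Fin n) K) M] : ℕ∞ :=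
  sSup {d : ℕ∞ | ∃ rs : List (MvPolynomial (Fin n) K),
    (∀ r ∈ rs, r ∈ idealOfVars (Fin n) K) ∧ RingTheory.Sequence.IsRegular M rs ∧
      d = (rs.length : ℕ∞)}

/-- `u ∈ R / I` is homogeneous for the multigrading (`I` a monomial ideal), that is, `u` is the
class of a scalar multiple of a monomial. -/
def IsMultihomogeneous {I : Ideal (MvPolynomial (Fin n) K)}
    (u : MvPolynomial (Fin n) K ⧸ I) : Prop :=
  ∃ (a : Fin n →₀ ℕ) (c : K), u = Ideal.Quotient.mk I (monomial a c)

/-- The `K`-subspace `u K[Z] = {p u | p ∈ K[Z]}` of `R / I`, where `K[Z]` is the polynomial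
subring on the variables in `Z`. -/
noncomputable def stanleySpace {I : Ideal (MvPolynomial (Fin n) K)}
    (u : MvPolynomial (Fin n) K ⧸ I) (Z : Finset (Fin n)) :
    Submodule K (MvPolynomial (Fin n) K ⧸ I) :=
  (Subalgebra.toSubmodule (supported K (Z : Set (Fin n)))).map
    ((LinearMap.toSpanSingleton (MvPolynomial (Fin n) K) (MvPolynomial (Fin n) K ⧸ I)
      u).restrictScalars K)

/-- A Stanley decomposition of `R / I`: a finite direct sum decomposition
`R / I = ⨁ⱼ uⱼ K[Zⱼ]` as a `K`-vector space, where each `uⱼ` is homogeneous and each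
`uⱼ K[Zⱼ]` is a free `K[Zⱼ]`-module with basis `uⱼ`. -/
structure IsStanleyDecomposition (I : Ideal (MvPolynomial (Fin n) K)) {r : ℕ}
    (u : Fin r → MvPolynomial (Fin n) K ⧸ I) (Z : Fin r → Finset (Fin n)) : Prop where
  homogeneous : ∀ j, IsMultihomogeneous (u j)
  free : ∀ j, ∀ p ∈ supported K (Z j : Set (Fin n)), p • u j = 0 → p = 0
  isInternal : DirectSum.IsInternal fun j => stanleySpace (u j) (Z j)

/-- The Stanley depth of `R / I`: the maximum over all Stanley decompositions
`R / I = ⨁ⱼ uⱼ K[Zⱼ]` of `minⱼ |Zⱼ|`. -/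
noncomputable def sdepth (I : Ideal (MvPolynomial (Fin n) K)) : ℕ∞ :=
  sSup {d : ℕ∞ | ∃ (r : ℕ) (u : Fin r → MvPolynomial (Fin n) K ⧸ I) (Z : Fin r → Finset (Fin n)),
    IsStanleyDecomposition I u Z ∧ d = ⨅ j, ((Z j).card : ℕ∞)}

end StanleyIneq

namespace StanleyIneq

open MvPolynomial

variable {K : Type*} [Field K] {n : ℕ}

/-! A Stanley decomposition by monomials is a partition of the exponents outside `I` into cones.
Every ass-decomposable `I` has one whose cones have dimension at least the minimum of `dim R/p` over
`p ∈ ass I` (`IsAssDecomposable.hasConePartition`). The primary case is explicit. In the recursive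
case the partitions for `(I, xᵢᵏ)` and `I : xᵢᵏ` are glued, and both ideals have their associated
primes in `ass I`, so the bound is inherited. For unmixed `I` the minimum is `dim R/I`, which bounds
the length of every regular sequence. -/

/-- The set `b + ℕ^Z` of exponents of the monomials in `x^b K[Z]`. -/
def cone (b : Fin n →₀ ℕ) (Z : Finset (Fin n)) : Set (Fin n →₀ ℕ) :=
  {a | b ≤ a ∧ ∀ i ∉ Z, a i = b i}

/-- The exponents of the monomials outside `I` are partitioned into finitely many cones
`b + ℕ^Z` with `d ≤ |Z|`. -/
def HasConePartition (I : Ideal (MvPolynomial (Fin n) K)) (d : WithBot ℕ∞) : Prop :=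
  ∃ (ι : Type) (_ : Finite ι) (b : ι → Fin n →₀ ℕ) (Z : ι → Finset (Fin n)),
    (∀ j, d ≤ ((Z j).card : ℕ∞)) ∧
    (∀ a, monomial a (1 : K) ∉ I → ∃! j, a ∈ cone (b j) (Z j)) ∧
    ∀ j, ∀ a ∈ cone (b j) (Z j), monomial a (1 : K) ∉ I

/-! ### Monomials in `(I, xᵢᵏ)` and `I : xᵢᵏ` -/

theorem IsMonomialIdeal.mem_iff {I : Ideal (MvPolynomial (Fin n) K)} (hI : IsMonomialIdeal I)
    (f : MvPolynomial (Fin n) K) : f ∈ I ↔ ∀ a ∈ f.support, monomial a (1 : K) ∈ I := by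
  classical
  obtain ⟨S, rfl⟩ := hI
  simp [mem_ideal_span_monomial_image, support_monomial]

theorem monomial_mem_of_le {I : Ideal (MvPolynomial (Fin n) K)} {a b : Fin n →₀ ℕ} (hab : a ≤ b)
    (ha : monomial a (1 : K) ∈ I) : monomial b (1 : K) ∈ I := by
  have h : monomial b (1 : K) = monomial (b - a) 1 * monomial a 1 := by
    rw [monomial_mul, tsub_add_cancel_of_le hab, one_mul]
  exact h ▸ I.mul_mem_left _ ha

theorem monomial_mem_sup_span_X_pow {I : Ideal (MvPolynomial (Fin n) K)} (hI : IsMonomialIdeal I)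
    (i : Fin n) (k : ℕ) (a : Fin n →₀ ℕ) :
    monomial a (1 : K) ∈ I ⊔ Ideal.span {(X i : MvPolynomial (Fin n) K) ^ k} ↔
      monomial a (1 : K) ∈ I ∨ k ≤ a i := by
  classical
  obtain ⟨S, rfl⟩ := hI
  have h : Ideal.span {(X i : MvPolynomial (Fin n) K) ^ k} =
      Ideal.span ((fun a => monomial a (1 : K)) '' {Finsupp.single i k}) := by
    rw [Set.image_singleton, X_pow_eq_monomial]
  rw [h, ← Ideal.span_union, ← Set.image_union]
  simp only [mem_ideal_span_monomial_image, support_monomial, one_ne_zero, if_false,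
    Finset.mem_singleton, forall_eq, Set.mem_union, Set.mem_singleton_iff, or_and_right, exists_or,
    exists_eq_left, Finsupp.single_le_iff]

theorem monomial_mem_colon_X_pow (I : Ideal (MvPolynomial (Fin n) K)) (i : Fin n) (k : ℕ)
    (a : Fin n →₀ ℕ) :
    monomial a (1 : K) ∈ Submodule.colon I {(X i : MvPolynomial (Fin n) K) ^ k} ↔
      monomial (a + Finsupp.single i k) (1 : K) ∈ I := by
  rw [Submodule.mem_colon_singleton, smul_eq_mul, X_pow_eq_monomial, monomial_mul, one_mul]

/-- Monomials outside `I` with `xᵢ`-exponent below `k` are those outside `(I, xᵢᵏ)`; the remaining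
ones are `xᵢᵏ` times the monomials outside `I : xᵢᵏ`, so the second family of cones is shifted. -/
theorem HasConePartition.of_sup_of_colon {I : Ideal (MvPolynomial (Fin n) K)}
    (hI : IsMonomialIdeal I) (i : Fin n) (k : ℕ) {d : WithBot ℕ∞}
    (hsup : HasConePartition (I ⊔ Ideal.span {(X i : MvPolynomial (Fin n) K) ^ k}) d)
    (hcolon : HasConePartition (Submodule.colon I {(X i : MvPolynomial (Fin n) K) ^ k}) d) :
    HasConePartition I d := by
  obtain ⟨ι₁, _, b₁, Z₁, hd₁, hex₁, hmem₁⟩ := hsup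
  obtain ⟨ι₂, _, b₂, Z₂, hd₂, hex₂, hmem₂⟩ := hcolon
  simp only [monomial_mem_sup_span_X_pow hI, not_or, not_le] at hex₁ hmem₁
  simp only [monomial_mem_colon_X_pow] at hex₂ hmem₂
  have hshift : ∀ (a b : Fin n →₀ ℕ) (Z : Finset (Fin n)),
      a ∈ cone (b + Finsupp.single i k) Z ↔ k ≤ a i ∧ a - Finsupp.single i k ∈ cone b Z := by
    intro a b Z
    constructor
    · rintro ⟨h₁, h₂⟩
      have hk : Finsupp.single i k ≤ a := le_trans le_add_self h₁
      refine ⟨Finsupp.single_le_iff.1 hk, le_tsub_of_add_le_right h₁, fun j hj => ?_⟩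
      rw [Finsupp.tsub_apply, h₂ j hj, Finsupp.add_apply, Nat.add_sub_cancel]
    · rintro ⟨hk, h₁, h₂⟩
      have hk : Finsupp.single i k ≤ a := Finsupp.single_le_iff.2 hk
      refine ⟨(le_tsub_iff_right hk).1 h₁, fun j hj => ?_⟩
      rw [Finsupp.add_apply, ← h₂ j hj, Finsupp.tsub_apply, Nat.sub_add_cancel (hk j)]
  refine ⟨ι₁ ⊕ ι₂, inferInstance, Sum.elim b₁ fun j => b₂ j + Finsupp.single i k,
    Sum.elim Z₁ Z₂, ?_, ?_, ?_⟩
  · rintro (j | j)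
    exacts [hd₁ j, hd₂ j]
  · intro a ha
    rcases lt_or_ge (a i) k with hk | hk
    · obtain ⟨j, hj, huniq⟩ := hex₁ a ⟨ha, hk⟩
      refine ⟨Sum.inl j, hj, ?_⟩
      rintro (j' | j') hj'
      · exact congrArg _ (huniq j' hj')
      · exact absurd ((hshift _ _ _).1 hj').1 hk.not_ge
    · have hsub : a - Finsupp.single i k + Finsupp.single i k = a :=
        tsub_add_cancel_of_le (Finsupp.single_le_iff.2 hk)
      obtain ⟨j, hj, huniq⟩ := hex₂ (a - Finsupp.single i k) (by rwa [hsub])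
      refine ⟨Sum.inr j, (hshift _ _ _).2 ⟨hk, hj⟩, ?_⟩
      rintro (j' | j') hj'
      · exact absurd (hmem₁ j' a hj').2 hk.not_gt
      · exact congrArg _ (huniq j' ((hshift _ _ _).1 hj').2)
  · rintro (j | j) a ha
    · exact (hmem₁ j a ha).1
    · obtain ⟨hk, h⟩ := (hshift _ _ _).1 ha
      have := hmem₂ j _ h
      rwa [tsub_add_cancel_of_le (Finsupp.single_le_iff.2 hk)] at this

/-! ### The primary case -/

theorem ringKrullDim_quotient_le_card {P : Ideal (MvPolynomial (Fin n) K)} (Z : Finset (Fin n))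
    (hZ : ∀ i ∉ Z, (X i : MvPolynomial (Fin n) K) ∈ P) :
    ringKrullDim (MvPolynomial (Fin n) K ⧸ P) ≤ (Z.card : ℕ∞) := by
  let f : MvPolynomial Z K →ₐ[K] MvPolynomial (Fin n) K ⧸ P :=
    (Ideal.Quotient.mkₐ K P).comp (rename ((↑) : Z → Fin n))
  have hf : Function.Surjective f := by
    rw [← AlgHom.range_eq_top, eq_top_iff]
    have htop : (⊤ : Subalgebra K (MvPolynomial (Fin n) K ⧸ P)) =
        (Algebra.adjoin K (Set.range X)).map (Ideal.Quotient.mkₐ K P) := by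
      rw [adjoin_range_X, Algebra.map_top, eq_comm, AlgHom.range_eq_top]
      exact Ideal.Quotient.mkₐ_surjective K P
    rw [htop, AlgHom.map_adjoin, Algebra.adjoin_le_iff]
    rintro _ ⟨_, ⟨i, rfl⟩, rfl⟩
    by_cases hi : i ∈ Z
    · exact ⟨X ⟨i, hi⟩, by simp [f]⟩
    · exact ⟨0, by
        rw [map_zero, eq_comm]
        exact Ideal.Quotient.eq_zero_iff_mem.2 (hZ i hi)⟩
  refine (ringKrullDim_le_of_surjective f.toRingHom hf).trans ?_
  rw [MvPolynomial.ringKrullDim_of_isNoetherianRing, ringKrullDim_eq_zero_of_field]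
  simp

/-- The variables outside `√I` are nonzerodivisors modulo `I`, so membership of a monomial depends
only on its part in the variables of `√I`, and only finitely many such parts lie outside `I`. -/
theorem HasConePartition.of_isPrimary {I : Ideal (MvPolynomial (Fin n) K)} (hI : I.IsPrimary) :
    HasConePartition I (ringKrullDim (MvPolynomial (Fin n) K ⧸ I.radical)) := by
  classical
  have hprime : I.radical.IsPrime := Ideal.isPrime_radical hI
  let S : Finset (Fin n) := {i | (X i : MvPolynomial (Fin n) K) ∈ I.radical}
  have hS : ∀ i, i ∈ S ↔ (X i : MvPolynomial (Fin n) K) ∈ I.radical := fun i => by simp [S]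
  -- `N` bounds the exponents of elements of `B`, since `xᵢ ^ N ∈ I` for `i ∈ S`.
  obtain ⟨N, hN⟩ := Ideal.exists_radical_pow_le_of_fg I (IsNoetherian.noetherian _)
  let B : Set (Fin n →₀ ℕ) := {b | monomial b (1 : K) ∉ I ∧ ∀ i ∉ S, b i = 0}
  have hB : B.Finite := by
    refine (Set.finite_Iic (Finsupp.equivFunOnFinite.symm fun _ : Fin n => N)).subset ?_
    rintro b ⟨hb, hb'⟩ i
    by_cases hi : i ∈ S
    · by_contra! hlt
      refine hb (monomial_mem_of_le (Finsupp.single_le_iff.2 hlt.le) ?_)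
      change monomial (Finsupp.single i N) (1 : K) ∈ I
      rw [← X_pow_eq_monomial]
      exact hN (Ideal.pow_mem_pow ((hS i).1 hi) N)
    · rw [hb' i hi]
      exact Nat.zero_le _
  refine ⟨B, hB.to_subtype, fun b => b, fun _ => Sᶜ, fun _ => ?_, fun a ha => ?_, fun b a hba => ?_⟩
  · exact ringKrullDim_quotient_le_card _ fun i hi => (hS i).1 (by simpa using hi)
  · have hle : a.filter (· ∈ S) ≤ a := fun i => by
      rw [Finsupp.filter_apply]
      split_ifs
      exacts [le_rfl, Nat.zero_le _]
    refine ⟨⟨a.filter (· ∈ S), fun h => ha (monomial_mem_of_le hle h),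
      fun i hi => Finsupp.filter_apply_neg _ _ hi⟩, ⟨hle, fun i hi => ?_⟩, ?_⟩
    · rw [Finsupp.filter_apply_pos _ _ (by simpa using hi)]
    · rintro ⟨b, hb, hb'⟩ ⟨-, h⟩
      ext i
      by_cases hi : i ∈ S
      · simp [Finsupp.filter_apply_pos _ _ hi, h i (by simpa using hi)]
      · simp [Finsupp.filter_apply_neg _ _ hi, hb' i hi]
  · intro ha
    have hmul : monomial a (1 : K) = monomial b.1 1 * monomial (a - b.1) 1 := by
      rw [monomial_mul, add_tsub_cancel_of_le hba.1, one_mul]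
    rw [hmul] at ha
    rcases (Ideal.isPrimary_iff.1 hI).2 ha with h | h
    · exact b.2.1 h
    -- A monomial in the prime `√I` involves a variable of `S`, but `a - b` vanishes on `S`.
    · rw [monomial_eq, C_1, one_mul, Finsupp.prod] at h
      obtain ⟨i, hi, h⟩ := (hprime.prod_mem_iff).1 h
      have hiS : i ∈ S := (hS i).2 (hprime.mem_of_pow_mem _ h)
      rw [Finsupp.mem_support_iff, Finsupp.tsub_apply, hba.2 i (by simpa using hiS)] at hi
      exact hi (Nat.sub_self _)

/-- Multiplication by `f` embeds `R/(I : f)` into `R/I`. -/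
theorem ass_colon_subset (I : Ideal (MvPolynomial (Fin n) K)) (f : MvPolynomial (Fin n) K) :
    ass (Submodule.colon I {f}) ⊆ ass I := by
  let φ : MvPolynomial (Fin n) K →ₗ[MvPolynomial (Fin n) K] MvPolynomial (Fin n) K ⧸ I :=
    LinearMap.toSpanSingleton _ _ (Ideal.Quotient.mk I f)
  have hφ : LinearMap.ker φ = Submodule.colon I {f} := by
    ext g
    rw [LinearMap.mem_ker, LinearMap.toSpanSingleton_apply, Submodule.mem_colon_singleton,
      smul_eq_mul, ← Ideal.Quotient.eq_zero_iff_mem, map_mul]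
    rfl
  have h : Function.Injective ((Submodule.colon I {f}).liftQ φ hφ.ge) := by
    rw [← LinearMap.ker_eq_bot, Submodule.ker_liftQ_eq_bot _ _ _ hφ.le]
  exact associatedPrimes.subset_of_injective h

theorem IsAssDecomposable.isMonomialIdeal {I : Ideal (MvPolynomial (Fin n) K)}
    (hI : IsAssDecomposable I) : IsMonomialIdeal I := by
  cases hI <;> assumption

theorem IsAssDecomposable.hasConePartition {I : Ideal (MvPolynomial (Fin n) K)}
    (hI : IsAssDecomposable I) {d : WithBot ℕ∞}
    (hd : ∀ p ∈ ass I, d ≤ ringKrullDim (MvPolynomial (Fin n) K ⧸ p)) :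
    HasConePartition I d := by
  induction hI with
  | primary I _ hp =>
    obtain ⟨ι, hι, b, Z, hZ, h⟩ := HasConePartition.of_isPrimary hp
    refine ⟨ι, hι, b, Z, fun j => (hd I.radical ?_).trans (hZ j), h⟩
    rw [ass, associatedPrimes.eq_singleton_of_isPrimary hp]
    rfl
  | step I hI i k _ _ hass _ _ ihadd ihcolon =>
    refine .of_sup_of_colon hI i k (ihadd fun p hp => hd p ?_)
      (ihcolon fun p hp => hd p (ass_colon_subset _ _ hp))
    rw [hass] at hp
    exact hp.1

/-! ### From cones to Stanley decompositions -/

theorem support_mul_monomial_subset_cone {p : MvPolynomial (Fin n) K} {Z : Finset (Fin n)}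
    (hp : p ∈ supported K (Z : Set (Fin n))) (b : Fin n →₀ ℕ) :
    ((p * monomial b 1).support : Set (Fin n →₀ ℕ)) ⊆ cone b Z := by
  intro a ha
  rw [Finset.mem_coe, mem_support_iff, coeff_mul_monomial'] at ha
  split_ifs at ha with hba
  · refine ⟨hba, fun i hi => ?_⟩
    by_contra hne
    have hlt : b i < a i := lt_of_le_of_ne (hba i) (Ne.symm hne)
    refine hi (mem_supported.1 hp ((mem_vars_iff_mem_support i).2 ⟨a - b, ?_, ?_⟩))
    · rw [mul_one] at ha
      exact mem_support_iff.2 ha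
    · rw [Finsupp.mem_support_iff, Finsupp.tsub_apply]
      omega
  · exact absurd rfl ha

theorem mem_stanleySpace_monomial {I : Ideal (MvPolynomial (Fin n) K)} {b : Fin n →₀ ℕ}
    {Z : Finset (Fin n)} {y : MvPolynomial (Fin n) K ⧸ I} :
    y ∈ stanleySpace (Ideal.Quotient.mk I (monomial b 1)) Z ↔
      ∃ p ∈ supported K (Z : Set (Fin n)), Ideal.Quotient.mk I (p * monomial b 1) = y := by
  rfl

theorem monomial_mem_stanleySpace (I : Ideal (MvPolynomial (Fin n) K)) {a b : Fin n →₀ ℕ}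
    {Z : Finset (Fin n)} (ha : a ∈ cone b Z) (c : K) :
    Ideal.Quotient.mk I (monomial a c) ∈
      stanleySpace (Ideal.Quotient.mk I (monomial b (1 : K))) Z := by
  classical
  refine mem_stanleySpace_monomial.2 ⟨monomial (a - b) c, ?_, ?_⟩
  · rw [mem_supported]
    intro i hi
    obtain ⟨m, hm, hi⟩ := (mem_vars_iff_mem_support i).1 hi
    rw [Finset.mem_singleton.1 (support_monomial_subset hm), Finsupp.mem_support_iff,
      Finsupp.tsub_apply] at hi
    by_contra hiZ
    exact hi (by rw [ha.2 i hiZ, Nat.sub_self])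
  · rw [monomial_mul, tsub_add_cancel_of_le ha.1, mul_one]

theorem isStanleyDecomposition_of_cones {I : Ideal (MvPolynomial (Fin n) K)}
    (hI : IsMonomialIdeal I) {r : ℕ} {b : Fin r → Fin n →₀ ℕ} {Z : Fin r → Finset (Fin n)}
    (hex : ∀ a, monomial a (1 : K) ∉ I → ∃! j, a ∈ cone (b j) (Z j))
    (hmem : ∀ j, ∀ a ∈ cone (b j) (Z j), monomial a (1 : K) ∉ I) :
    IsStanleyDecomposition I (fun j => Ideal.Quotient.mk I (monomial (b j) (1 : K))) Z where
  homogeneous j := ⟨b j, 1, rfl⟩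
  free j p hp h := by
    have hmemI : p * monomial (b j) 1 ∈ I := Ideal.Quotient.eq_zero_iff_mem.1 h
    have h0 : p * monomial (b j) 1 = 0 := by
      rw [← support_eq_empty, Finset.eq_empty_iff_forall_notMem]
      exact fun a ha => hmem j a (support_mul_monomial_subset_cone hp (b j) ha)
        ((hI.mem_iff _).1 hmemI a ha)
    exact (mul_eq_zero.1 h0).resolve_right (by simp [monomial_eq_zero])
  isInternal := by
    rw [DirectSum.isInternal_submodule_iff_iSupIndep_and_iSup_eq_top]
    constructor
    · intro j
      rw [Submodule.disjoint_def]
      intro y hy hy'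
      obtain ⟨p, hp, rfl⟩ := mem_stanleySpace_monomial.1 hy
      -- Sums from the other cones lift to polynomials supported off cone `j`. Such a lift cannot
      -- cancel any term of `p * monomial (b j) 1`, and `I` is tested termwise.
      have hle : ⨆ (i) (_ : i ≠ j),
          stanleySpace (Ideal.Quotient.mk I (monomial (b i) (1 : K))) (Z i) ≤
          (restrictSupport K (cone (b j) (Z j))ᶜ).map (Ideal.Quotient.mkₐ K I).toLinearMap := by
        refine iSup₂_le fun i hij y hy => ?_
        obtain ⟨q, hq, rfl⟩ := mem_stanleySpace_monomial.1 hy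
        refine ⟨_, (mem_restrictSupport_iff K).2 fun a ha ha' => hij ?_, rfl⟩
        exact (hex a (hmem j a ha')).unique (support_mul_monomial_subset_cone hq (b i) ha) ha'
      obtain ⟨q, hq, hqp⟩ := hle hy'
      have hsub : q - p * monomial (b j) 1 ∈ I := Ideal.Quotient.eq.1 hqp
      have h0 : p * monomial (b j) 1 = 0 := by
        rw [← support_eq_empty, Finset.eq_empty_iff_forall_notMem]
        intro a ha
        have hac := support_mul_monomial_subset_cone hp (b j) ha
        refine hmem j a hac ((hI.mem_iff _).1 hsub a ?_)
        have hqa : coeff a q = 0 := by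
          by_contra hne
          exact (mem_restrictSupport_iff K).1 hq (mem_support_iff.2 hne) hac
        rw [mem_support_iff, coeff_sub, hqa, zero_sub, neg_ne_zero]
        exact mem_support_iff.1 ha
      rw [h0, map_zero]
    · rw [eq_top_iff]
      rintro y -
      obtain ⟨f, rfl⟩ := Ideal.Quotient.mk_surjective y
      rw [f.as_sum, map_sum]
      refine Submodule.sum_mem _ fun a _ => ?_
      by_cases ha : monomial a (1 : K) ∈ I
      · have h : monomial a (coeff a f) ∈ I := by
          rw [← mul_one (coeff a f), ← C_mul_monomial]
          exact I.mul_mem_left _ ha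
        rw [Ideal.Quotient.eq_zero_iff_mem.2 h]
        exact Submodule.zero_mem _
      · obtain ⟨j, hj, -⟩ := hex a ha
        exact Submodule.mem_iSup_of_mem j (monomial_mem_stanleySpace I hj _)

theorem HasConePartition.le_sdepth {I : Ideal (MvPolynomial (Fin n) K)} (hI : IsMonomialIdeal I)
    {d : ℕ∞} (h : HasConePartition I d) : d ≤ sdepth I := by
  obtain ⟨ι, _, b, Z, hd, hex, hmem⟩ := h
  obtain ⟨r, ⟨e⟩⟩ := Finite.exists_equiv_fin ι
  refine le_trans (le_iInf fun j => ?_) (le_sSup ⟨r, _, fun j => Z (e.symm j),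
    isStanleyDecomposition_of_cones hI (b := fun j => b (e.symm j)) (fun a ha => ?_)
      (fun j => hmem _), rfl⟩)
  · exact WithBot.coe_le_coe.1 (hd (e.symm j))
  · exact e.existsUnique_congr_left.1 (hex a ha)

/-- A regular element avoids the minimal primes of the support, so each quotient lowers the
dimension by at least one. -/
theorem length_le_supportDim_of_isRegular {R : Type*} [CommRing R] [IsNoetherianRing R]
    {M : Type*} [AddCommGroup M] [Module R M] [Module.Finite R M] {rs : List R}
    (hrs : RingTheory.Sequence.IsRegular M rs) :
    ((rs.length : ℕ∞) : WithBot ℕ∞) ≤ Module.supportDim R M := by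
  induction rs generalizing M with
  | nil =>
    have : Nontrivial M := hrs.nontrivial
    have h := Module.supportDim_ne_bot_of_nontrivial R M
    obtain ⟨m, hm⟩ := WithBot.ne_bot_iff_exists.1 h
    rw [← hm]
    exact WithBot.coe_le_coe.2 zero_le
  | cons x rs ih =>
    obtain ⟨hx, hrs⟩ := (RingTheory.Sequence.isRegular_cons_iff M x rs).1 hrs
    refine le_trans ?_ (Module.supportDim_quotSMulTop_succ_le_of_notMem_minimalPrimes
      fun _ => hx.notMem_of_mem_minimalPrimes)
    rw [List.length_cons, Nat.cast_succ, WithBot.coe_add]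
    exact add_le_add (ih hrs) le_rfl

end StanleyIneq

theorem mainTheorem8 {K : Type*} [Field K] {n : ℕ} (I : Ideal (MvPolynomial (Fin n) K))
    (hI : StanleyIneq.IsAssDecomposable I) (hunm : StanleyIneq.IsUnmixed I) :
    StanleyIneq.depth (K := K) (n := n) (MvPolynomial (Fin n) K ⧸ I) ≤
      StanleyIneq.sdepth I := by
  refine sSup_le ?_
  rintro _ ⟨rs, -, hrs, rfl⟩
  refine StanleyIneq.HasConePartition.le_sdepth hI.isMonomialIdeal
    (hI.hasConePartition fun p hp => ?_)
  -- Unmixedness turns the bound required at each `p` into one by `dim R/I`.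
  rw [← hunm p hp, ← Module.supportDim_quotient_eq_ringKrullDim]
  exact StanleyIneq.length_le_supportDim_of_isRegular hrs
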